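/- Let $k$ be an algebraically closed field, let $n\ge d\ge 1$ and $D\ge 2$ be integers, and let $\mathcal A=\{\mathbf a_0,\dots,\mathbf a_n\}\subset\mathbb N^d$ be a set of $n+1$ vectors $\mathbf a_i=(a_{i1},\dots,a_{id})$ such that $\{\mathbf 0,D\epsilon_1',\dots,D\epsilon_d'\}\subset\mathcal A$ and $|\mathbf a_i|:=a_{i1}+\dots+a_{id}\le D$ for all $i$, where $\epsilon_1',\dots,\epsilon_d'$ is the canonical basis of $\mathbb N^d$. Let $\underline{\mathcal A}=\{\underline{\mathbf a}_0,\dots,\underline{\mathbf a}_n\}\subset\mathbb N^{d+1}$ with $\underline{\mathbf a}_i=(D-|\mathbf a_i|,a_{i1},\dots,a_{id})$ be the homogenization of $\mathcal A$, and assume that the greatest common divisor of all the coordinates of all the vectors of $\underline{\mathcal A}$ is $1$. Let $\mathcal X_{\underline{\mathcal A}}=V(I_{\underline{\mathcal A}})\subset\mathbb P^n_k$, where $I_{\underline{\mathcal A}}$ is the kernel of the homomorphism of $k$-algebras $k[x_0,\dots,x_n]\to k[t_0,\dots,t_d]$, $x_i\mapsto \mathbf t^{\underline{\mathbf a}_i}$.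 For $s\in\mathbb N$ let $s\mathcal A$ be the set of all sums of $s$ (not necessarily distinct) elements of $\mathcal A$, with $0\mathcal A=\{\mathbf 0\}$, and let $\Delta_s=\{\mathbf y\in\mathbb N^d\mid y_1+\dots+y_d\le sD\}$. The following conditions are equivalent: (a) $\mathcal X_{\underline{\mathcal A}}$ is smooth. (b) $\{\epsilon_i+(D-1)\epsilon_j\mid 0\le i,j\le d\}\subset\underline{\mathcal A}$, where $\epsilon_0,\dots,\epsilon_d$ is the canonical basis of $\mathbb N^{d+1}$. (c) $\{\mathbf 0,\ \epsilon_i',\ (D-1)\epsilon_i',\ \epsilon_i'+(D-1)\epsilon_j'\mid 1\le i,j\le d\}\subset\mathcal A$. (d) There exists $s_0\in\mathbb N$ such that $s\mathcal A=\Delta_s$ for all $s\ge s_0$. -/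

import Mathlib

open CategoryTheory

namespace SimplicialToric

universe u

/-! ### Sumsets -/

/-- The `s`-fold sumset `sA = {a₁ + ⋯ + a_s | a₁, …, a_s ∈ A}`; in particular `0A = {0}`. -/
def sumset {d : ℕ} (s : ℕ) (A : Set (Fin d → ℕ)) : Set (Fin d → ℕ) :=
  {y | ∃ f : Fin s → (Fin d → ℕ), (∀ i, f i ∈ A) ∧ y = ∑ i, f i}

/-- `Δ_s = {y ∈ ℕ^d | y₁ + ⋯ + y_d ≤ sD}`. -/
def simplex (d D s : ℕ) : Set (Fin d → ℕ) :=
  {y | ∑ j, y j ≤ s * D}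

/-- The homogenization `(D - |a|, a₁, …, a_d)` of a vector `a ∈ ℕ^d` with `|a| ≤ D`. -/
def homogenize {d : ℕ} (D : ℕ) (a : Fin d → ℕ) : Fin (d + 1) → ℕ :=
  Fin.cons (D - ∑ j, a j) a

theorem sum_homogenize {d D : ℕ} {a : Fin d → ℕ} (h : ∑ j, a j ≤ D) :
    ∑ j, homogenize D a j = D := by
  simp only [homogenize, Fin.sum_univ_succ, Fin.cons_zero, Fin.cons_succ]
  omega

/-! ### Closed subschemes of projective space -/

section Quotient

variable {k R : Type u} [CommRing k] [CommRing R] [Algebra k R]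
  (𝒜 : ℕ → Submodule k R) [GradedAlgebra 𝒜] (I : HomogeneousIdeal 𝒜)

/-- The grading on `R ⧸ I` for a homogeneous ideal `I` of a graded `k`-algebra `R`:
the degree `i` part is the image of the degree `i` part of `R`. -/
def quotientGrading (i : ℕ) : Submodule k (R ⧸ I.toIdeal) :=
  (𝒜 i).map (Ideal.Quotient.mkₐ k I.toIdeal).toLinearMap

instance quotientGrading_gradedMonoid : SetLike.GradedMonoid (quotientGrading 𝒜 I) where
  one_mem := ⟨1, SetLike.GradedOne.one_mem, map_one (Ideal.Quotient.mkₐ k I.toIdeal)⟩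
  mul_mem := by
    rintro i j _ _ ⟨x, hx, rfl⟩ ⟨y, hy, rfl⟩
    exact ⟨x * y, SetLike.GradedMul.mul_mem hx hy, map_mul (Ideal.Quotient.mkₐ k I.toIdeal) x y⟩

theorem quotientGrading_isInternal : DirectSum.IsInternal (quotientGrading 𝒜 I) := by
  classical
  let q : R →ₗ[k] R ⧸ I.toIdeal := (Ideal.Quotient.mkₐ k I.toIdeal).toLinearMap
  have hq : ∀ x, q x = 0 ↔ x ∈ I.toIdeal := fun x => Ideal.Quotient.eq_zero_iff_mem
  constructor
  · rw [injective_iff_map_eq_zero]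
    intro z hz
    have hx : ∀ i, ∃ x ∈ 𝒜 i, q x = (z i : R ⧸ I.toIdeal) := fun i => (z i).2
    choose x hx hxz using hx
    have hsum : ∑ i ∈ z.support, x i ∈ I.toIdeal := by
      rw [← hq, map_sum, ← hz, DirectSum.coeAddMonoidHom_eq_dfinsuppSum, DFinsupp.sum]
      exact Finset.sum_congr rfl fun i _ => hxz i
    ext i
    by_cases hi : i ∈ z.support
    · have h := I.isHomogeneous i hsum
      rw [DirectSum.decompose_sum, DFinsupp.finsetSum_apply, AddSubmonoidClass.coe_finsetSum,
        Finset.sum_eq_single i] at h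
      · rw [DirectSum.decompose_of_mem_same _ (hx i)] at h
        rw [← hxz i, (hq _).2 h]
        simp
      · intro j _ hj
        exact DirectSum.decompose_of_mem_ne _ (hx j) hj
      · exact fun h => absurd hi h
    · simp only [DFinsupp.mem_support_toFun, ne_eq, not_not] at hi
      simp [hi]
  · intro y
    obtain ⟨x, rfl⟩ := Ideal.Quotient.mk_surjective y
    refine ⟨∑ i ∈ (DirectSum.decompose 𝒜 x).support, DirectSum.of (fun i => quotientGrading 𝒜 I i) i
      ⟨q (DirectSum.decompose 𝒜 x i), _, (DirectSum.decompose 𝒜 x i).2, rfl⟩, ?_⟩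
    rw [map_sum]
    simp only [DirectSum.coeAddMonoidHom_of]
    rw [← map_sum, DirectSum.sum_support_decompose]
    rfl

noncomputable instance quotientGrading_gradedAlgebra : GradedAlgebra (quotientGrading 𝒜 I) where
  toDecomposition := (quotientGrading_isInternal 𝒜 I).chooseDecomposition

end Quotient

section Toric

attribute [local instance] MvPolynomial.gradedAlgebra

/-- The closed subscheme `V(I) = Proj (k[x₀, …, x_n] ⧸ I)` of `ℙⁿ_k` cut out by a homogeneous
ideal `I` of `k[x₀, …, x_n]`. -/
noncomputable def projScheme {k : Type u} [Field k] {n : ℕ}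
    (I : HomogeneousIdeal (MvPolynomial.homogeneousSubmodule (Fin (n + 1)) k)) :
    AlgebraicGeometry.Scheme.{u} :=
  AlgebraicGeometry.Proj (quotientGrading (MvPolynomial.homogeneousSubmodule (Fin (n + 1)) k) I)

/-- The structure morphism `V(I) ⟶ Spec k`. -/
noncomputable def projSchemeToSpec {k : Type u} [Field k] {n : ℕ}
    (I : HomogeneousIdeal (MvPolynomial.homogeneousSubmodule (Fin (n + 1)) k)) :
    projScheme I ⟶ AlgebraicGeometry.Spec (CommRingCat.of k) :=
  AlgebraicGeometry.Proj.toSpecZero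
      (quotientGrading (MvPolynomial.homogeneousSubmodule (Fin (n + 1)) k) I) ≫
    AlgebraicGeometry.Spec.map (CommRingCat.ofHom (algebraMap k
      (quotientGrading (MvPolynomial.homogeneousSubmodule (Fin (n + 1)) k) I 0)))

/-! ### Projective toric varieties -/

/-- The homomorphism of `k`-algebras `k[x₀, …, x_n] → k[t₀, …, t_d]`, `x_i ↦ t^{b_i}`. -/
noncomputable def toricHom (k : Type u) [Field k] {n d : ℕ} (b : Fin (n + 1) → Fin (d + 1) → ℕ) :
    MvPolynomial (Fin (n + 1)) k →ₐ[k] MvPolynomial (Fin (d + 1)) k :=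
  MvPolynomial.aeval fun i => ∏ j, MvPolynomial.X j ^ b i j

theorem toricHom_isHomogeneous (k : Type u) [Field k] {n d D : ℕ}
    {b : Fin (n + 1) → Fin (d + 1) → ℕ} (hb : ∀ i, ∑ j, b i j = D)
    {f : MvPolynomial (Fin (n + 1)) k} {m : ℕ} (hf : f.IsHomogeneous m) :
    (toricHom k b f).IsHomogeneous (D * m) := by
  refine hf.aeval _ fun i => ?_
  rw [← hb i]
  refine MvPolynomial.IsHomogeneous.prod _ _ _ fun j _ => ?_
  simpa using (MvPolynomial.isHomogeneous_X k j).pow (b i j)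

/-- The toric ideal `I_b ⊂ k[x₀, …, x_n]` of vectors `b₀, …, b_n ∈ ℕ^{d+1}` with
`|b_i| = D > 0` for all `i`: the kernel of `x_i ↦ t^{b_i}`. It is a homogeneous ideal. -/
noncomputable def toricIdeal (k : Type u) [Field k] {n d D : ℕ} (hD : 0 < D)
    (b : Fin (n + 1) → Fin (d + 1) → ℕ) (hb : ∀ i, ∑ j, b i j = D) :
    HomogeneousIdeal (MvPolynomial.homogeneousSubmodule (Fin (n + 1)) k) where
  toSubmodule := RingHom.ker (toricHom k b)
  is_homogeneous' := by
    intro m f hf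
    rw [RingHom.mem_ker] at hf ⊢
    change toricHom k b (MvPolynomial.decomposition.decompose' f m) = 0
    rw [MvPolynomial.decomposition.decompose'_apply]
    have h := congrArg (MvPolynomial.homogeneousComponent (D * m)) hf
    rw [map_zero, ← MvPolynomial.sum_homogeneousComponent f, map_sum, map_sum] at h
    by_cases hm : m ∈ Finset.range (f.totalDegree + 1)
    · rw [Finset.sum_eq_single_of_mem m hm] at h
      · rwa [MvPolynomial.homogeneousComponent_of_mem (toricHom_isHomogeneous k hb
          (MvPolynomial.homogeneousComponent_isHomogeneous m f)), if_pos rfl] at h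
      · intro l _ hl
        rw [MvPolynomial.homogeneousComponent_of_mem (toricHom_isHomogeneous k hb
          (MvPolynomial.homogeneousComponent_isHomogeneous l f)), if_neg]
        exact fun h' => hl (Nat.eq_of_mul_eq_mul_left hD h').symm
    · have hlt : f.totalDegree < m := by
        by_contra hle
        exact hm (Finset.mem_range.2 (by omega))
      rw [MvPolynomial.homogeneousComponent_eq_zero _ _ hlt, map_zero]

/-- The projective toric variety `X_b = V(I_b) ⊂ ℙⁿ_k`. -/
noncomputable def toricVariety (k : Type u) [Field k] {n d D : ℕ} (hD : 0 < D)
    (b : Fin (n + 1) → Fin (d + 1) → ℕ) (hb : ∀ i, ∑ j, b i j = D) :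
    AlgebraicGeometry.Scheme.{u} :=
  projScheme (toricIdeal k hD b hb)

/-- The structure morphism `X_b ⟶ Spec k`. -/
noncomputable def toricVarietyToSpec (k : Type u) [Field k] {n d D : ℕ} (hD : 0 < D)
    (b : Fin (n + 1) → Fin (d + 1) → ℕ) (hb : ∀ i, ∑ j, b i j = D) :
    toricVariety k hD b hb ⟶ AlgebraicGeometry.Spec (CommRingCat.of k) :=
  projSchemeToSpec (toricIdeal k hD b hb)

end Toric

end SimplicialToric

namespace SimplicialToric

/-! ### Sumsets of homogenized vectors -/

section Sumset

variable {d : ℕ} {B : Set (Fin d → ℕ)}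

/-! Everything is compared with condition (b), stated for the homogenized vectors, where all `d + 1`
vertices `D e_j` play the same role.

Sumsets: if every `e_i + (D - 1) e_j` is available, a vector of degree `s D` with one large
coordinate `j` is decomposed by dividing the other coordinates by `D` and absorbing the remainders
with the vectors `e_i + (D - 1) e_j` (`mem_sumset_of_large_coord`). For large `s` some coordinate is
always large. Conversely, a decomposition of `e_i + (s D - 1) e_j` has exactly one summand involving
`e_i`, and that summand must be `e_i + (D - 1) e_j`.

Smoothness: the charts at the vertices cover `X`, and the chart at `D e_j` is the spectrum of the
algebra of the monoid `S_j` generated by the exponents with coordinate `j` dropped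
(`exists_chartRing_equiv`, `iSup_basicOpen_vertex`). Under (b) each `S_j` is `ℕ^d`, so the charts
are affine spaces. Conversely, a formally smooth monoid algebra has arcs through the origin in every
tangent direction, which excludes relations `n c = ∑ m_i w_i` among distinct irreducibles
(`nsmul_ne_sum_nsmul_of_formallySmooth`). The minimal axis elements `α_i e_i` of `S_j` are
irreducible, and every element has a multiple in their span, so they are the only irreducibles and
`α_i` divides every `i`-th coordinate (`dvd_of_formallySmooth`). Comparing different vertices, `α_i`
divides all coordinates of all vectors, so the gcd condition gives `α_i = 1`. -/

theorem zero_mem_sumset : (0 : Fin d → ℕ) ∈ sumset 0 B :=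
  ⟨Fin.elim0, fun i => i.elim0, by simp⟩

theorem mem_sumset_one {x : Fin d → ℕ} (hx : x ∈ B) : x ∈ sumset 1 B :=
  ⟨fun _ => x, fun _ => hx, by simp⟩

theorem add_mem_sumset {s t : ℕ} {x y : Fin d → ℕ} (hx : x ∈ sumset s B) (hy : y ∈ sumset t B) :
    x + y ∈ sumset (s + t) B := by
  obtain ⟨f, hf, rfl⟩ := hx
  obtain ⟨g, hg, rfl⟩ := hy
  refine ⟨Fin.append f g, fun i => ?_, ?_⟩
  · induction i using Fin.addCases with
    | left i => simpa using hf i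
    | right i => simpa using hg i
  · simp [Fin.sum_univ_add]

theorem nsmul_mem_sumset {x : Fin d → ℕ} (hx : x ∈ B) (m : ℕ) : m • x ∈ sumset m B := by
  induction m with
  | zero => simpa using zero_mem_sumset
  | succ m ih =>
    rw [succ_nsmul]
    exact add_mem_sumset ih (mem_sumset_one hx)

theorem sum_mem_sumset {ι : Type*} (t : Finset ι) (m : ι → ℕ) (x : ι → Fin d → ℕ)
    (hx : ∀ i ∈ t, x i ∈ sumset (m i) B) : ∑ i ∈ t, x i ∈ sumset (∑ i ∈ t, m i) B := by
  classical
  induction t using Finset.induction_on with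
  | empty => simpa using zero_mem_sumset
  | insert i t hi ih =>
    rw [Finset.sum_insert hi, Finset.sum_insert hi]
    exact add_mem_sumset (hx i (by simp)) (ih fun j hj => hx j (by simp [hj]))

/-- If `B` contains all `e_i + (D - 1) e_j`, then every vector of degree `s D` with a large
coordinate is a sum of `s` elements of `B`. -/
theorem mem_sumset_of_large_coord {D : ℕ} (hD : 0 < D)
    (hB : ∀ i j : Fin d, Pi.single i 1 + Pi.single j (D - 1) ∈ B) {s : ℕ} {Y : Fin d → ℕ}
    (hY : ∑ i, Y i = s * D) (j : Fin d) (hj : D * (d * D) ≤ Y j) : Y ∈ sumset s B := by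
  have hvert (i : Fin d) : Pi.single i D ∈ B := by
    have h := hB i i
    rwa [← Pi.single_add, Nat.add_sub_cancel' (by omega : 1 ≤ D)] at h
  set t := Finset.univ.erase j with ht
  set Q := ∑ i ∈ t, Y i / D with hQ
  set R := ∑ i ∈ t, Y i % D with hR
  have hsum : ∑ i ∈ t, Y i = D * Q + R := by
    rw [hQ, hR, Finset.mul_sum, ← Finset.sum_add_distrib]
    exact Finset.sum_congr rfl fun i _ => (Nat.div_add_mod _ _).symm
  have htot : Y j + (D * Q + R) = s * D := by
    rw [← hsum, ← hY, ht, Finset.add_sum_erase _ _ (Finset.mem_univ j)]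
  have hRle : R ≤ d * D := by
    refine (Finset.sum_le_card_nsmul t _ D fun i _ => (Nat.mod_lt _ hD).le).trans ?_
    rw [smul_eq_mul]
    exact Nat.mul_le_mul_right _ ((Finset.card_le_univ _).trans (by simp))
  -- The size of `Y j` is needed only here: `Q` copies of vertices and `R` mixed vectors must not
  -- exceed the `s` summands allowed. The remaining `c` summands are copies of `D e_j`, and the
  -- degree forces the `j`-th coordinates to agree.
  have hDR : D * R ≤ Y j := (Nat.mul_le_mul_left D hRle).trans hj
  have hle : Q + R ≤ s := by
    refine Nat.le_of_mul_le_mul_left (c := D) ?_ hD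
    rw [mul_add, mul_comm D s]
    omega
  obtain ⟨c, rfl⟩ := Nat.exists_eq_add_of_le hle
  have hYj : Y j = (D - 1) * R + c * D := by
    obtain ⟨E, rfl⟩ : ∃ E, D = E + 1 := ⟨D - 1, by omega⟩
    simp only [Nat.add_sub_cancel]
    nlinarith
  have key : Y = (∑ i ∈ t, ((Y i / D) • Pi.single i D +
      (Y i % D) • (Pi.single i 1 + Pi.single j (D - 1)))) + c • Pi.single j D := by
    funext m
    simp only [Pi.add_apply, Finset.sum_apply, Pi.smul_apply, smul_eq_mul]
    by_cases hm : m = j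
    · subst hm
      rw [Finset.sum_congr rfl (g := fun i => (D - 1) * (Y i % D)), ← Finset.mul_sum, ← hR]
      · simpa using hYj
      · intro i hi
        have : m ≠ i := fun h => by simp [ht, h] at hi
        simp [Pi.single_eq_of_ne this, mul_comm]
    · rw [Finset.sum_eq_single_of_mem m (by simp [ht, hm])]
      · simp [Pi.single_eq_of_ne hm, mul_comm, Nat.div_add_mod]
      · intro i _ hi
        simp [Pi.single_eq_of_ne hm, Pi.single_eq_of_ne hi.symm]
  rw [key]
  refine add_mem_sumset ?_ (nsmul_mem_sumset (hvert j) c)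
  rw [hQ, hR, ← Finset.sum_add_distrib]
  exact sum_mem_sumset _ _ _ fun i _ =>
    add_mem_sumset (nsmul_mem_sumset (hvert i) _) (nsmul_mem_sumset (hB i j) _)

theorem exists_forall_mem_sumset {D : ℕ} (hD : 0 < D) {B : Set (Fin (d + 1) → ℕ)}
    (hB : ∀ i j, Pi.single i 1 + Pi.single j (D - 1) ∈ B) :
    ∃ s₀ : ℕ, ∀ s ≥ s₀, ∀ Y : Fin (d + 1) → ℕ, ∑ i, Y i = s * D → Y ∈ sumset s B := by
  -- Pigeonhole: `d + 1` times the bound required of a single coordinate.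
  refine ⟨(d + 1) * (D * ((d + 1) * D)), fun s hs Y hY => ?_⟩
  obtain ⟨j, -, hj⟩ : ∃ j ∈ Finset.univ, D * ((d + 1) * D) ≤ Y j := by
    refine Finset.exists_le_of_sum_le Finset.univ_nonempty ?_
    rw [hY]
    simp only [Finset.sum_const, Finset.card_univ, Fintype.card_fin, smul_eq_mul]
    exact hs.trans (Nat.le_mul_of_pos_right s hD)
  exact mem_sumset_of_large_coord hD hB hY j hj

/-- The `i`-th coordinates of the summands add up to `1`, so some summand has `i`-th coordinate `1`.
Its coordinates off `i` and `j` vanish, and its degree `D` fixes the `j`-th one. -/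
theorem single_add_single_mem_of_mem_sumset {D s : ℕ} (hD : 0 < D)
    (hdeg : ∀ x ∈ B, ∑ i, x i = D) {i j : Fin d} (hij : i ≠ j)
    (h : Pi.single i 1 + Pi.single j (s * D - 1) ∈ sumset s B) :
    Pi.single i 1 + Pi.single j (D - 1) ∈ B := by
  obtain ⟨f, hf, hsum⟩ := h
  have hi : ∑ l, f l i = 1 := by
    simpa [Pi.single_eq_of_ne hij] using (congrFun hsum i).symm
  obtain ⟨l, -, hl⟩ : ∃ l ∈ Finset.univ, f l i ≠ 0 :=
    Finset.exists_ne_zero_of_sum_ne_zero (by omega)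
  have hli : f l i = 1 := by
    have := Finset.single_le_sum (f := fun l => f l i) (fun _ _ => Nat.zero_le _)
      (Finset.mem_univ l)
    omega
  have hlm (m) (hmi : m ≠ i) (hmj : m ≠ j) : f l m = 0 := by
    have h0 : ∑ l, f l m = 0 := by
      simpa [Pi.single_eq_of_ne hmi, Pi.single_eq_of_ne hmj] using (congrFun hsum m).symm
    exact Finset.sum_eq_zero_iff.1 h0 l (Finset.mem_univ l)
  have hlj : 1 + f l j = D := by
    rw [← hdeg _ (hf l), ← hli, ← Finset.sum_pair hij]
    refine Finset.sum_subset (Finset.subset_univ _) fun m _ hm => ?_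
    simp only [Finset.mem_insert, Finset.mem_singleton, not_or] at hm
    exact hlm m hm.1 hm.2
  convert hf l using 1
  funext m
  by_cases hmi : m = i
  · subst hmi
    simp [Pi.single_eq_of_ne hij, hli]
  · by_cases hmj : m = j
    · subst hmj
      simp [Pi.single_eq_of_ne hmi]
      omega
    · simp [Pi.single_eq_of_ne hmi, Pi.single_eq_of_ne hmj, hlm m hmi hmj]

end Sumset

/-! ### Passing between vectors and their homogenizations -/

section Homogenize

variable {d D : ℕ}

theorem homogenize_tail {Y : Fin (d + 1) → ℕ} (hY : ∑ i, Y i = D) :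
    homogenize D (Fin.tail Y) = Y := by
  rw [Fin.sum_univ_succ] at hY
  rw [homogenize]
  conv_rhs => rw [← Fin.cons_self_tail Y]
  congr 1
  simp only [Fin.tail]
  omega

theorem tail_homogenize (a : Fin d → ℕ) : Fin.tail (homogenize D a) = a := Fin.tail_cons _ _

theorem mem_range_homogenize_iff {ι : Type*} {a : ι → Fin d → ℕ} (hdeg : ∀ i, ∑ j, a i j ≤ D)
    {Y : Fin (d + 1) → ℕ} :
    Y ∈ Set.range (fun l => homogenize D (a l)) ↔ ∑ i, Y i = D ∧ Fin.tail Y ∈ Set.range a := by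
  constructor
  · rintro ⟨l, rfl⟩
    exact ⟨sum_homogenize (hdeg l), l, (tail_homogenize _).symm⟩
  · rintro ⟨hY, l, hl⟩
    exact ⟨l, by simp only [hl, homogenize_tail hY]⟩

theorem tail_sum {s : ℕ} (f : Fin s → Fin (d + 1) → ℕ) :
    Fin.tail (∑ l, f l) = ∑ l, Fin.tail (f l) := by
  funext m
  simp [Fin.tail]

/-- In a vector of prescribed degree the zeroth coordinate is determined by the others, so dropping
it loses nothing. The inclusion of the sumset in the simplex is automatic; only the reverse one
carries content. -/
theorem sumset_eq_simplex_iff {ι : Type*} {a : ι → Fin d → ℕ} (hdeg : ∀ i, ∑ j, a i j ≤ D)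
    (s : ℕ) :
    sumset s (Set.range a) = simplex d D s ↔ ∀ Y : Fin (d + 1) → ℕ, ∑ i, Y i = s * D →
      Y ∈ sumset s (Set.range fun l => homogenize D (a l)) := by
  constructor
  · intro h Y hY
    have hmem : Fin.tail Y ∈ simplex d D s := by
      rw [Fin.sum_univ_succ] at hY
      simp only [simplex, Set.mem_ofPred_eq, Fin.tail]
      omega
    rw [← h] at hmem
    obtain ⟨f, hf, hsum⟩ := hmem
    have hfD (l) : ∑ j, f l j ≤ D := by
      obtain ⟨i, hi⟩ := hf l
      exact hi ▸ hdeg i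
    refine ⟨fun l => homogenize D (f l), fun l => ?_, ?_⟩
    · obtain ⟨i, hi⟩ := hf l
      exact ⟨i, by simp only [hi]⟩
    · rw [← homogenize_tail hY, hsum, ← homogenize_tail (D := s * D) (Y := ∑ l, homogenize D (f l)),
        tail_sum]
      · simp only [tail_homogenize]
      · simp only [Finset.sum_apply]
        rw [Finset.sum_comm, Finset.sum_congr rfl fun l _ => sum_homogenize (hfD l)]
        simp
  · intro h
    ext y
    constructor
    · rintro ⟨f, hf, rfl⟩
      have hfD (l) : ∑ j, f l j ≤ D := by
        obtain ⟨i, hi⟩ := hf l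
        exact hi ▸ hdeg i
      simp only [simplex, Set.mem_ofPred_eq, Finset.sum_apply]
      rw [Finset.sum_comm]
      exact (Finset.sum_le_card_nsmul _ _ D fun l _ => hfD l).trans (by simp)
    · intro hy
      obtain ⟨f, hf, hsum⟩ := h (homogenize (s * D) y) (sum_homogenize hy)
      refine ⟨fun l => Fin.tail (f l), fun l => ((mem_range_homogenize_iff hdeg).1 (hf l)).2, ?_⟩
      rw [← tail_sum, ← hsum, tail_homogenize]

theorem tail_add (x y : Fin (d + 1) → ℕ) : Fin.tail (x + y) = Fin.tail x + Fin.tail y := rfl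

theorem tail_single_zero (m : ℕ) : Fin.tail (Pi.single 0 m : Fin (d + 1) → ℕ) = 0 := by
  funext i
  simp [Fin.tail]

theorem tail_single_succ (i : Fin d) (m : ℕ) :
    Fin.tail (Pi.single i.succ m : Fin (d + 1) → ℕ) = Pi.single i m := by
  funext j
  by_cases h : j = i
  · simp [Fin.tail, h]
  · simp [Fin.tail, Pi.single_eq_of_ne h, Pi.single_eq_of_ne ((Fin.succ_injective _).ne h)]

theorem single_mem_range_homogenize {ι : Type*} {a : ι → Fin d → ℕ}
    (hdeg : ∀ i, ∑ j, a i j ≤ D) (hzero : 0 ∈ Set.range a)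
    (hvert : ∀ i : Fin d, Pi.single i D ∈ Set.range a) (i : Fin (d + 1)) :
    Pi.single i D ∈ Set.range (fun l => homogenize D (a l)) := by
  rw [mem_range_homogenize_iff hdeg]
  refine ⟨by simp, ?_⟩
  induction i using Fin.cases with
  | zero => rwa [tail_single_zero]
  | succ i => rw [tail_single_succ]; exact hvert i

theorem single_add_single_mem_range_homogenize_iff {ι : Type*} {a : ι → Fin d → ℕ}
    (hD : 0 < D) (hdeg : ∀ i, ∑ j, a i j ≤ D) (i j : Fin (d + 1)) :
    Pi.single i 1 + Pi.single j (D - 1) ∈ Set.range (fun l => homogenize D (a l)) ↔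
      Fin.tail (Pi.single i 1 : Fin (d + 1) → ℕ) + Fin.tail (Pi.single j (D - 1) : Fin (d + 1) → ℕ) ∈
        Set.range a := by
  rw [mem_range_homogenize_iff hdeg, ← tail_add, and_iff_right]
  simp [Finset.sum_add_distrib]
  omega

theorem forall_single_add_single_mem_iff {ι : Type*} {a : ι → Fin d → ℕ}
    (hD : 0 < D) (hdeg : ∀ i, ∑ j, a i j ≤ D) :
    (∀ i j : Fin (d + 1),
      Pi.single i 1 + Pi.single j (D - 1) ∈ Set.range (fun l => homogenize D (a l))) ↔
    0 ∈ Set.range a ∧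
      (∀ i : Fin d, Pi.single i 1 ∈ Set.range a ∧ Pi.single i (D - 1) ∈ Set.range a) ∧
      ∀ i j : Fin d, Pi.single i 1 + Pi.single j (D - 1) ∈ Set.range a := by
  simp only [single_add_single_mem_range_homogenize_iff hD hdeg, Fin.forall_fin_succ,
    tail_single_zero, tail_single_succ, zero_add, add_zero, and_assoc, forall_and]

/-- The combinatorial part of the equivalence: the sumsets eventually fill the simplices if and
only if all `e_i + (D - 1) e_j` occur. -/
theorem exists_forall_sumset_eq_simplex_iff {ι : Type*} {a : ι → Fin d → ℕ}
    (hD : 0 < D) (hdeg : ∀ i, ∑ j, a i j ≤ D) (hzero : 0 ∈ Set.range a)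
    (hvert : ∀ i : Fin d, Pi.single i D ∈ Set.range a) :
    (∃ s₀ : ℕ, ∀ s ≥ s₀, sumset s (Set.range a) = simplex d D s) ↔
    ∀ i j : Fin (d + 1),
      Pi.single i 1 + Pi.single j (D - 1) ∈ Set.range (fun l => homogenize D (a l)) := by
  simp only [sumset_eq_simplex_iff hdeg]
  refine ⟨fun ⟨s₀, h⟩ i j => ?_, fun h => exists_forall_mem_sumset hD h⟩
  by_cases hij : i = j
  · subst hij
    rw [← Pi.single_add, Nat.add_sub_cancel' (by omega : 1 ≤ D)]
    exact single_mem_range_homogenize hdeg hzero hvert i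
  -- `s₀` may be `0`; the successor keeps `s * D - 1` from being truncated.
  · refine single_add_single_mem_of_mem_sumset (s := s₀ + 1) hD ?_ hij (h _ (by omega) _ ?_)
    · rintro _ ⟨l, rfl⟩
      exact sum_homogenize (hdeg l)
    · have : 1 ≤ (s₀ + 1) * D := Nat.mul_pos (by omega) hD
      simp [Finset.sum_add_distrib]
      omega

end Homogenize

end SimplicialToric

namespace SimplicialToric

/-! ### Formally smooth monoid algebras -/

section TruncatedPolynomial

open Polynomial

variable {k : Type*} [Field k]

/-- The left side has order exactly `a`, which the truncation at order `N > a` still detects, while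
the right side has order at least `a + 1`. -/
theorem truncated_pow_mul_ne {N a : ℕ} (ha : a < N)
    (z z' : k[X] ⧸ Ideal.span {(X : k[X]) ^ N}) :
    Ideal.Quotient.mk _ X ^ a * (1 + Ideal.Quotient.mk _ X * z) ≠
      Ideal.Quotient.mk _ X ^ (a + 1) * z' := by
  obtain ⟨p, rfl⟩ := Ideal.Quotient.mk_surjective z
  obtain ⟨q, rfl⟩ := Ideal.Quotient.mk_surjective z'
  intro h
  have h' : (X : k[X]) ^ N ∣ X ^ a * (1 + X * p) - X ^ (a + 1) * q := by
    rw [← Ideal.mem_span_singleton, ← Ideal.Quotient.eq]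
    simpa using h
  have h'' : (X : k[X]) ^ a * X ∣ X ^ a * (1 + X * (p - q)) := by
    rw [← pow_succ]
    refine (pow_dvd_pow X ha).trans (h'.trans (dvd_of_eq ?_))
    ring
  have h₁ := (mul_dvd_mul_iff_left (pow_ne_zero a X_ne_zero)).1 h''
  rw [X_dvd_iff] at h₁
  simp at h₁

end TruncatedPolynomial

section Arc

variable {R : Type*} [CommRing R]

theorem exists_one_add_mul_pow (x z : R) (n : ℕ) : ∃ z', (1 + x * z) ^ n = 1 + x * z' := by
  induction n with
  | zero => exact ⟨0, by simp⟩
  | succ n ih =>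
    obtain ⟨z', hz'⟩ := ih
    exact ⟨z' + z + x * z' * z, by rw [pow_succ, hz']; ring⟩

theorem exists_prod_one_add_mul {ι : Type*} (t : Finset ι) (x : R) (z : ι → R) :
    ∃ z', ∏ i ∈ t, (1 + x * z i) = 1 + x * z' := by
  classical
  induction t using Finset.induction_on with
  | empty => exact ⟨0, by simp⟩
  | insert i t hi ih =>
    obtain ⟨z', hz'⟩ := ih
    exact ⟨z i + z' + x * z i * z', by rw [Finset.prod_insert hi, hz']; ring⟩

variable {M : Type*} [AddCommMonoid M] [Subsingleton (AddUnits M)]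

open Classical in
/-- The multiplicative map `M → R` sending `0` to `1`, the elements of a set `T` of irreducible
elements to a square-zero element `e`, and everything else to `0`. -/
noncomputable def tangentHom (T : Set M) (hT : ∀ m ∈ T, AddIrreducible m) (e : R) (he : e * e = 0) :
    Multiplicative M →* R where
  toFun m := if m.toAdd = 0 then 1 else if m.toAdd ∈ T then e else 0
  map_one' := by simp
  map_mul' x y := by
    simp only [toAdd_mul]
    by_cases hx : x.toAdd = 0
    · simp [hx]
    by_cases hy : y.toAdd = 0
    · simp [hy]
    have hxy : x.toAdd + y.toAdd ≠ 0 := fun h => hx (add_eq_zero.1 h).1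
    have hxyT : x.toAdd + y.toAdd ∉ T := fun h => by
      rcases (hT _ h).isAddUnit_or_isAddUnit rfl with h | h
      · exact hx (isAddUnit_iff_eq_zero.1 h)
      · exact hy (isAddUnit_iff_eq_zero.1 h)
    rw [if_neg hxy, if_neg hxyT, if_neg hx, if_neg hy]
    split_ifs <;> simp [he]

open Polynomial

/-- A formally smooth monoid algebra has truncated arcs of every order with prescribed tangent
vector at the origin. -/
theorem exists_truncated_arc {k : Type*} [Field k]
    [Algebra.FormallySmooth k (AddMonoidAlgebra k M)] (T : Set M)
    (hT : ∀ m ∈ T, AddIrreducible m) (N : ℕ) :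
    ∃ φ : AddMonoidAlgebra k M →ₐ[k] (k[X] ⧸ Ideal.span {(X : k[X]) ^ N}),
      (∀ m ∈ T, ∃ z, φ (AddMonoidAlgebra.single m 1) =
        Ideal.Quotient.mk _ X * (1 + Ideal.Quotient.mk _ X * z)) ∧
      ∀ m, m ≠ 0 → m ∉ T → ∃ z, φ (AddMonoidAlgebra.single m 1) =
        Ideal.Quotient.mk _ X ^ 2 * z := by
  set x : k[X] ⧸ Ideal.span {(X : k[X]) ^ N} := Ideal.Quotient.mk _ X with hx
  have hxN : x ^ N = 0 := by
    rw [hx, ← map_pow, Ideal.Quotient.eq_zero_iff_mem]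
    exact Ideal.subset_span rfl
  -- Modulo `x ^ 2` the class of `x` squares to zero, so `tangentHom` gives a first-order arc. As
  -- `I` is nilpotent, formal smoothness lifts it to order `N`, changing values only by multiples of
  -- `x ^ 2`.
  let I : Ideal (k[X] ⧸ Ideal.span {(X : k[X]) ^ N}) := Ideal.span {x ^ 2}
  have hI : IsNilpotent I := ⟨N, by
    rw [Ideal.span_singleton_pow, ← pow_mul, mul_comm, pow_mul, hxN, Ideal.zero_eq_bot,
      Ideal.span_singleton_eq_bot]
    simp⟩
  have he : Ideal.Quotient.mk I x * Ideal.Quotient.mk I x = 0 := by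
    rw [← map_mul, ← pow_two, Ideal.Quotient.eq_zero_iff_mem]
    exact Ideal.subset_span rfl
  obtain ⟨φ, hφ⟩ := Algebra.FormallySmooth.exists_lift (R := k) I hI
    (AddMonoidAlgebra.lift k _ M (tangentHom T hT (Ideal.Quotient.mk I x) he))
  have hφ' (m : M) : Ideal.Quotient.mk I (φ (AddMonoidAlgebra.single m 1)) =
      tangentHom T hT (Ideal.Quotient.mk I x) he (Multiplicative.ofAdd m) := by
    have := AlgHom.congr_fun hφ (AddMonoidAlgebra.single m 1)
    simpa using this
  refine ⟨φ, fun m hm => ?_, fun m hm0 hmT => ?_⟩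
  · have h := hφ' m
    have hm0 : m ≠ 0 := fun h0 => (hT m hm).not_isAddUnit (by simp [h0])
    simp only [tangentHom, MonoidHom.coe_mk, OneHom.coe_mk, toAdd_ofAdd, hm0, if_false, hm,
      if_true] at h
    rw [Ideal.Quotient.eq, Ideal.mem_span_singleton] at h
    obtain ⟨z, hz⟩ := h
    exact ⟨z, by rw [← sub_add_cancel (φ _) x, hz]; ring⟩
  · have h := hφ' m
    simp only [tangentHom, MonoidHom.coe_mk, OneHom.coe_mk, toAdd_ofAdd, hm0, if_false, hmT] at h
    rwa [Ideal.Quotient.eq_zero_iff_mem, Ideal.mem_span_singleton] at h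

/-- In a monoid with formally smooth monoid algebra there is no relation `n c = ∑ m_i w_i` between
irreducible elements with `n > 0` and `c` not among the `w_i`. -/
theorem nsmul_ne_sum_nsmul_of_formallySmooth {k : Type*} [Field k]
    [Algebra.FormallySmooth k (AddMonoidAlgebra k M)] {ι : Type*} (t : Finset ι) (w : ι → M) (c : M)
    (hc : AddIrreducible c) (hw : ∀ i, AddIrreducible (w i)) (hcw : c ∉ Set.range w)
    (n : ℕ) (hn : 0 < n) (m : ι → ℕ) : n • c ≠ ∑ i ∈ t, m i • w i := by
  intro h
  have hrel {B : Type _} [CommRing B] [Algebra k B] (φ : AddMonoidAlgebra k M →ₐ[k] B) :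
      φ (AddMonoidAlgebra.single c 1) ^ n = ∏ i ∈ t, φ (AddMonoidAlgebra.single (w i) 1) ^ m i := by
    have key := congrArg (fun y => φ (AddMonoidAlgebra.of k M (Multiplicative.ofAdd y))) h
    simpa only [ofAdd_nsmul, ofAdd_sum, map_pow, map_prod, AddMonoidAlgebra.of_apply,
      toAdd_ofAdd] using key
  have hc0 : c ≠ 0 := fun h0 => hc.not_isAddUnit (by simp [h0])
  -- The tangent direction is chosen so that the side with fewer factors has order 1 in each, and
  -- the other side order at least 2 in each. The two sides of the relation then have different
  -- orders; the truncation is taken just beyond the smaller one or later.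
  rcases le_or_gt n (∑ i ∈ t, m i) with hle | hlt
  · obtain ⟨φ, hφ, hφ'⟩ := exists_truncated_arc (k := k) {c} (by simpa using hc) (n + 1)
    obtain ⟨z, hz⟩ := hφ c rfl
    have hwz (i) : ∃ z, φ (AddMonoidAlgebra.single (w i) 1) = Ideal.Quotient.mk _ X ^ 2 * z :=
      hφ' _ (fun h0 => (hw i).not_isAddUnit (by simp [h0])) fun h' => hcw ⟨i, h'⟩
    choose y hy using hwz
    have hr := hrel φ
    obtain ⟨z', hz'⟩ := exists_one_add_mul_pow (Ideal.Quotient.mk _ X) z n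
    simp only [hz, hy, mul_pow, hz', Finset.prod_mul_distrib, Finset.prod_pow_eq_pow_sum,
      ← pow_mul] at hr
    rw [← Finset.mul_sum] at hr
    obtain ⟨r, hr'⟩ := Nat.exists_eq_add_of_le (by omega : n + 1 ≤ 2 * ∑ i ∈ t, m i)
    rw [hr', pow_add _ (n + 1), mul_assoc] at hr
    exact truncated_pow_mul_ne (by omega) _ _ hr
  · obtain ⟨φ, hφ, hφ'⟩ := exists_truncated_arc (k := k) (Set.range w)
      (by rintro _ ⟨i, rfl⟩; exact hw i) n
    obtain ⟨z, hz⟩ := hφ' c hc0 hcw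
    have hwz (i) := hφ (w i) ⟨i, rfl⟩
    choose y hy using hwz
    have hr := hrel φ
    have hyz (i) := exists_one_add_mul_pow (Ideal.Quotient.mk _ X) (y i) (m i)
    choose y' hy' using hyz
    obtain ⟨z', hz'⟩ := exists_prod_one_add_mul t (Ideal.Quotient.mk _ X) y'
    simp only [hz, hy, mul_pow, hy', Finset.prod_mul_distrib, Finset.prod_pow_eq_pow_sum,
      ← pow_mul, hz'] at hr
    obtain ⟨r, hr'⟩ := Nat.exists_eq_add_of_le (by omega : (∑ i ∈ t, m i) + 1 ≤ 2 * n)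
    rw [hr', pow_add _ (_ + 1), mul_assoc] at hr
    exact truncated_pow_mul_ne hlt _ _ hr.symm

end Arc

/-- If `S ⊆ ℕ^ι` meets every coordinate axis and its monoid algebra is formally smooth, then the
smallest multiple `α_i` of `e_i` in `S` divides the `i`-th coordinate of all elements of `S`. -/
theorem dvd_of_formallySmooth (k : Type*) [Field k] {ι : Type*} [Fintype ι]
    (S : AddSubmonoid (ι →₀ ℕ)) [Algebra.FormallySmooth k (AddMonoidAlgebra k S)] (α : ι → ℕ)
    (hα : ∀ i, 0 < α i) (hαS : ∀ i, Finsupp.single i (α i) ∈ S)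
    (hmin : ∀ i m, 0 < m → Finsupp.single i m ∈ S → α i ≤ m) (y : ι →₀ ℕ) (hy : y ∈ S) (i : ι) :
    α i ∣ y i := by
  classical
  have hunits : Subsingleton (AddUnits S) := by
    refine ⟨fun u v => AddUnits.ext (Subtype.ext ?_)⟩
    have h0 (u : AddUnits S) : ((u : S) : ι →₀ ℕ) = 0 := by
      have h := congrArg Subtype.val u.add_neg
      simp only [AddSubmonoid.coe_add, AddSubmonoid.coe_zero] at h
      exact (add_eq_zero.1 h).1
    rw [h0, h0]
  let w (i : ι) : S := ⟨Finsupp.single i (α i), hαS i⟩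
  have hw (i : ι) : AddIrreducible (w i) := by
    refine ⟨fun h => ?_, fun x z h => ?_⟩
    · have h0 := congrArg Subtype.val (isAddUnit_iff_eq_zero.1 h)
      simp only [w, AddSubmonoid.coe_zero, Finsupp.single_eq_zero] at h0
      exact (hα i).ne' h0
    · have hv : Finsupp.single i (α i) = (x : ι →₀ ℕ) + z := congrArg Subtype.val h
      have hax (u v : ι →₀ ℕ) (huv : Finsupp.single i (α i) = u + v) :
          u = Finsupp.single i (u i) := by
        ext j
        by_cases hj : j = i
        · simp [hj]
        · have := DFunLike.congr_fun huv j
          simp only [Finsupp.add_apply, Finsupp.single_eq_of_ne hj] at this ⊢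
          omega
      have hx := hax x z hv
      have hz := hax z x (by rw [hv, add_comm])
      have hxz : α i = (x : ι →₀ ℕ) i + (z : ι →₀ ℕ) i := by
        simpa using DFunLike.congr_fun hv i
      simp only [isAddUnit_iff_eq_zero]
      by_contra! hne
      have hxi : 0 < (x : ι →₀ ℕ) i := Nat.pos_of_ne_zero fun h0 => hne.1 (Subtype.ext (by
        rw [hx, h0]; simp))
      have hzi : 0 < (z : ι →₀ ℕ) i := Nat.pos_of_ne_zero fun h0 => hne.2 (Subtype.ext (by
        rw [hz, h0]; simp))
      have := hmin i _ hxi (hx ▸ x.2)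
      omega
  have hirr (c : S) (hc : AddIrreducible c) : c ∈ Set.range w := by
    by_contra hcw
    -- Clearing denominators in `c = ∑ (c_i / α_i) w_i` gives the forbidden relation.
    refine nsmul_ne_sum_nsmul_of_formallySmooth (k := k) Finset.univ w c hc hw hcw (∏ i, α i)
      (Finset.prod_pos fun i _ => hα i) (fun i => (c : ι →₀ ℕ) i * ∏ j ∈ Finset.univ.erase i, α j)
      (Subtype.ext ?_)
    ext j
    simp only [AddSubmonoidClass.coe_nsmul, AddSubmonoid.coe_finsetSum, Finsupp.smul_apply,
      Finsupp.finsetSum_apply, smul_eq_mul, w]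
    rw [Finset.sum_eq_single j, Finsupp.single_eq_same,
      ← Finset.mul_prod_erase Finset.univ α (Finset.mem_univ j)]
    · ring
    · intro b _ hb
      simp [Finsupp.single_eq_of_ne hb.symm]
    · simp
  -- Decompose into irreducibles: a reducible `y` splits into two summands of smaller degree, and an
  -- irreducible one is some `w j`.
  induction hn : y.degree using Nat.strong_induction_on generalizing y with
  | _ n ih =>
  subst hn
  by_cases hy0 : y = 0
  · simp [hy0]
  by_cases hirry : AddIrreducible (⟨y, hy⟩ : S)
  · obtain ⟨j, hj⟩ := hirr _ hirry
    have hj' : Finsupp.single j (α j) = y := congrArg Subtype.val hj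
    rw [← hj']
    by_cases hij : i = j
    · simp [hij]
    · simp [Finsupp.single_eq_of_ne hij]
  · rw [addIrreducible_iff] at hirry
    simp only [isAddUnit_iff_eq_zero] at hirry
    push Not at hirry
    obtain ⟨x, z, hxz, hx0, hz0⟩ := hirry (fun h => hy0 (congrArg Subtype.val h))
    have hv : y = (x : ι →₀ ℕ) + z := congrArg Subtype.val hxz
    have hdeg : y.degree = (x : ι →₀ ℕ).degree + (z : ι →₀ ℕ).degree := by rw [hv, map_add]
    have hxd : (x : ι →₀ ℕ).degree ≠ 0 := fun h => hx0 (Subtype.ext ((Finsupp.degree_eq_zero_iff _).1 h))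
    have hzd : (z : ι →₀ ℕ).degree ≠ 0 := fun h => hz0 (Subtype.ext ((Finsupp.degree_eq_zero_iff _).1 h))
    rw [hv, Finsupp.add_apply]
    exact dvd_add (ih _ (by omega) _ x.2 rfl) (ih _ (by omega) _ z.2 rfl)

end SimplicialToric

namespace SimplicialToric

universe u

/-! ### Affine charts of projective toric varieties -/

section Dehomogenize

variable {k : Type*} [CommRing k] {σ : Type*}

/-- Setting the variable `t_j` equal to `1`. -/
noncomputable def dehomogenize (k : Type*) [CommRing k] {σ : Type*} (j : σ) :
    MvPolynomial σ k →ₐ[k] MvPolynomial {i // i ≠ j} k :=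
  AddMonoidAlgebra.mapDomainAlgHom k k (Finsupp.subtypeDomainAddMonoidHom (M := ℕ) (p := (· ≠ j)))

theorem dehomogenize_monomial (j : σ) (m : σ →₀ ℕ) (r : k) :
    dehomogenize k j (MvPolynomial.monomial m r) =
      MvPolynomial.monomial (m.subtypeDomain (· ≠ j)) r :=
  AddMonoidAlgebra.mapDomain_single

/-- The exponent of `t_j` is recovered from the others and the degree, so distinct monomials of
degree `N` stay distinct. -/
theorem dehomogenize_injOn [Fintype σ] (j : σ) (N : ℕ) :
    Set.InjOn (dehomogenize k j) {p | p.IsHomogeneous N} := by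
  classical
  have hinj : Set.InjOn (Finsupp.subtypeDomain (M := ℕ) (· ≠ j)) {m : σ →₀ ℕ | m.degree = N} := by
    intro m hm m' hm' h
    simp only [Set.mem_ofPred_eq, Finsupp.degree_eq_sum] at hm hm'
    have hne (i) (hi : i ≠ j) : m i = m' i := DFunLike.congr_fun h ⟨i, hi⟩
    ext i
    by_cases hi : i = j
    · subst hi
      rw [← Finset.add_sum_erase _ _ (Finset.mem_univ i)] at hm hm'
      have : ∑ l ∈ Finset.univ.erase i, m l = ∑ l ∈ Finset.univ.erase i, m' l :=
        Finset.sum_congr rfl fun l hl => hne l (Finset.ne_of_mem_erase hl)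
      omega
    · exact hne i hi
  have hsupp {p : MvPolynomial σ k} (hp : p.IsHomogeneous N) :
      (AddMonoidAlgebra.coeff p) ∈
        {w : (σ →₀ ℕ) →₀ k | (w.support : Set (σ →₀ ℕ)) ⊆ {m | m.degree = N}} := by
    intro m hm
    by_contra hne
    exact (Finsupp.mem_support_iff.1 hm) (hp.coeff_eq_zero hne)
  intro p hp q hq h
  have h' := congrArg AddMonoidAlgebra.coeff h
  exact AddMonoidAlgebra.coeff_injective (Finsupp.mapDomain_injOn _ hinj (hsupp hp) (hsupp hq) h')

end Dehomogenize

theorem smooth_basicOpen_ι_comp {A τ : Type u} [CommRing A] [SetLike τ A] [AddSubgroupClass τ A]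
    (𝒜 : ℕ → τ) [GradedRing 𝒜] {f : A} {m : ℕ} (hf : f ∈ 𝒜 m) (hm : 0 < m)
    {Y : AlgebraicGeometry.Scheme.{u}} (g : AlgebraicGeometry.Proj 𝒜 ⟶ Y)
    (h : AlgebraicGeometry.Smooth (AlgebraicGeometry.Proj.awayι 𝒜 f hf hm ≫ g)) :
    AlgebraicGeometry.Smooth ((AlgebraicGeometry.Proj.basicOpen 𝒜 f).ι ≫ g) := by
  rw [← (AlgebraicGeometry.Proj.basicOpenIsoSpec 𝒜 f hf hm).hom_inv_id_assoc
    (AlgebraicGeometry.Proj.basicOpen 𝒜 f).ι, AlgebraicGeometry.Proj.basicOpenIsoSpec_inv_ι,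
    Category.assoc]
  exact AlgebraicGeometry.smooth_comp _ _

/-! ### Vertex charts as spectra of monoid algebras -/

section Chart

attribute [local instance] MvPolynomial.gradedAlgebra

variable (k : Type u) [Field k] {n d D : ℕ} (hD : 0 < D)
  (b : Fin (n + 1) → Fin (d + 1) → ℕ) (hb : ∀ i, ∑ j, b i j = D)

/-- The homogeneous coordinate ring of `X_b`. -/
abbrev toricRing : Type u := MvPolynomial (Fin (n + 1)) k ⧸ (toricIdeal k hD b hb).toIdeal

/-- The grading on the homogeneous coordinate ring of `X_b`. -/
noncomputable abbrev toricGrading : ℕ → Submodule k (toricRing k hD b hb) :=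
  quotientGrading (MvPolynomial.homogeneousSubmodule (Fin (n + 1)) k) (toricIdeal k hD b hb)

/-- The coordinate function `x_l` on `X_b`. -/
noncomputable def toricCoord (l : Fin (n + 1)) : toricRing k hD b hb :=
  Ideal.Quotient.mk _ (MvPolynomial.X l)

/-- The embedding of the homogeneous coordinate ring of `X_b` into `k[t₀, …, t_d]`. -/
noncomputable def toricEval : toricRing k hD b hb →ₐ[k] MvPolynomial (Fin (d + 1)) k :=
  Ideal.Quotient.liftₐ _ (toricHom k b) fun _ ha => ha

theorem toricEval_injective : Function.Injective (toricEval k hD b hb) := by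
  rw [injective_iff_map_eq_zero]
  intro a ha
  obtain ⟨p, rfl⟩ := Ideal.Quotient.mk_surjective a
  exact Ideal.Quotient.eq_zero_iff_mem.2 ha

theorem toricHom_X (l : Fin (n + 1)) : toricHom k b (MvPolynomial.X l) =
    MvPolynomial.monomial (Finsupp.equivFunOnFinite.symm (b l)) 1 := by
  rw [toricHom, MvPolynomial.aeval_X, MvPolynomial.monomial_eq, Finsupp.prod_fintype _ _ (by simp)]
  simp

theorem toricEval_coord (l : Fin (n + 1)) : toricEval k hD b hb (toricCoord k hD b hb l) =
    MvPolynomial.monomial (Finsupp.equivFunOnFinite.symm (b l)) 1 :=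
  toricHom_X k b l

theorem toricCoord_mem (l : Fin (n + 1)) :
    toricCoord k hD b hb l ∈ toricGrading k hD b hb 1 :=
  ⟨MvPolynomial.X l, MvPolynomial.isHomogeneous_X k l, rfl⟩

theorem isHomogeneous_toricEval {m : ℕ} {x : toricRing k hD b hb}
    (hx : x ∈ toricGrading k hD b hb m) : (toricEval k hD b hb x).IsHomogeneous (D * m) := by
  obtain ⟨p, hp, rfl⟩ := hx
  exact toricHom_isHomogeneous k hb hp

/-- The exponent vector `y` without its `j`-th coordinate. -/
noncomputable def chartExponent (j : Fin (d + 1)) (y : Fin (d + 1) → ℕ) : {i // i ≠ j} →₀ ℕ :=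
  Finsupp.equivFunOnFinite.symm fun i => y i

@[simp]
theorem chartExponent_apply (j : Fin (d + 1)) (y : Fin (d + 1) → ℕ) (i : {i // i ≠ j}) :
    chartExponent j y i = y i := rfl

/-- The monoid of exponents of the chart of `X_b` at the vertex `D e_j`. -/
noncomputable def chartMonoid (j : Fin (d + 1)) : AddSubmonoid ({i // i ≠ j} →₀ ℕ) :=
  AddSubmonoid.closure (Set.range fun l => chartExponent j (b l))

/-- Evaluation of the homogeneous coordinates at `t_j = 1`. -/
noncomputable def affineEval (j : Fin (d + 1)) :
    toricRing k hD b hb →ₐ[k] MvPolynomial {i // i ≠ j} k :=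
  (dehomogenize k j).comp (toricEval k hD b hb)

theorem affineEval_coord (j : Fin (d + 1)) (l : Fin (n + 1)) :
    affineEval k hD b hb j (toricCoord k hD b hb l) =
      MvPolynomial.monomial (chartExponent j (b l)) 1 := by
  rw [affineEval, AlgHom.comp_apply, toricEval_coord, dehomogenize_monomial]
  congr 2
  ext i
  rfl

variable {b} {j : Fin (d + 1)} {v : Fin (n + 1)} (hv : b v = Pi.single j D)

include hv in
theorem affineEval_vertex : affineEval k hD b hb j (toricCoord k hD b hb v) = 1 := by
  rw [affineEval_coord]
  have : chartExponent j (b v) = 0 := by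
    ext i
    simp [hv, Pi.single_eq_of_ne i.2]
  rw [this]
  rfl

open HomogeneousLocalization

/-- The coordinate ring of the chart `D₊(x_v)` of `X_b`. -/
abbrev chartRing (b : Fin (n + 1) → Fin (d + 1) → ℕ) (hb : ∀ i, ∑ j, b i j = D)
    (v : Fin (n + 1)) : Type u :=
  Away (toricGrading k hD b hb) (toricCoord k hD b hb v)

/-- The structure map of the coordinate ring of the chart `D₊(x_v)`. -/
noncomputable def chartStructure (b : Fin (n + 1) → Fin (d + 1) → ℕ) (hb : ∀ i, ∑ j, b i j = D)
    (v : Fin (n + 1)) : k →+* chartRing k hD b hb v :=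
  (fromZeroRingHom (toricGrading k hD b hb) (Submonoid.powers (toricCoord k hD b hb v))).comp
    (algebraMap k (toricGrading k hD b hb 0))

/-- The embedding of the coordinate ring of a vertex chart into a polynomial ring. -/
noncomputable def chartHom : chartRing k hD b hb v →+* MvPolynomial {i // i ≠ j} k :=
  (IsLocalization.Away.lift (S := Localization.Away (toricCoord k hD b hb v))
    (g := (affineEval k hD b hb j).toRingHom) (toricCoord k hD b hb v)
    (by
      change IsUnit (affineEval k hD b hb j (toricCoord k hD b hb v))
      rw [affineEval_vertex k hD hb hv]; exact isUnit_one)).comp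
    (algebraMap (chartRing k hD b hb v) (Localization.Away (toricCoord k hD b hb v)))

theorem chartHom_mk (c : NumDenSameDeg (toricGrading k hD b hb)
    (Submonoid.powers (toricCoord k hD b hb v))) :
    chartHom k hD hb hv (HomogeneousLocalization.mk c) = affineEval k hD b hb j c.num := by
  obtain ⟨m, hm⟩ := c.den_mem
  have hden : affineEval k hD b hb j c.den = 1 := by
    rw [← hm]
    simp only [map_pow, affineEval_vertex k hD hb hv, one_pow]
  rw [chartHom, RingHom.comp_apply, HomogeneousLocalization.algebraMap_apply, val_mk, Localization.mk_eq_mk',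
    IsLocalization.Away.lift, IsLocalization.lift_mk'_spec]
  change affineEval k hD b hb j c.num = affineEval k hD b hb j c.den * affineEval k hD b hb j c.num
  rw [hden, one_mul]

theorem chartHom_structure (r : k) :
    chartHom k hD hb hv (chartStructure k hD b hb v r) = algebraMap k _ r := by
  rw [chartStructure, RingHom.comp_apply]
  refine (chartHom_mk k hD hb hv _).trans ?_
  exact (affineEval k hD b hb j).commutes r

/-- Only the numerator matters, since the denominator evaluates to `1`. The numerator embeds as a
homogeneous polynomial, on which setting `t_j = 1` is injective. -/
theorem chartHom_injective : Function.Injective (chartHom k hD hb hv) := by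
  rw [injective_iff_map_eq_zero]
  intro x hx
  obtain ⟨c, rfl⟩ := HomogeneousLocalization.mk_surjective x
  rw [chartHom_mk] at hx
  refine mk_eq_zero_of_num c (Subtype.ext (toricEval_injective k hD b hb ?_))
  refine dehomogenize_injOn j (D * c.deg) (isHomogeneous_toricEval k hD b hb c.num.2) ?_ ?_
  · simpa using MvPolynomial.isHomogeneous_zero _ _ _
  · rw [ZeroMemClass.coe_zero, map_zero, map_zero]
    exact hx

theorem affineEval_mem_range (j : Fin (d + 1)) (x : toricRing k hD b hb) :
    affineEval k hD b hb j x ∈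
      (AddMonoidAlgebra.mapDomainAlgHom k k (chartMonoid b j).subtype).range := by
  obtain ⟨p, rfl⟩ := Ideal.Quotient.mk_surjective x
  induction p using MvPolynomial.induction_on with
  | C r =>
    have := (affineEval k hD b hb j).commutes r
    exact this ▸ Subalgebra.algebraMap_mem _ r
  | add p q hp hq =>
    rw [map_add, map_add]
    exact add_mem hp hq
  | mul_X p l hp =>
    rw [map_mul, map_mul]
    refine mul_mem hp ?_
    have hl : chartExponent j (b l) ∈ chartMonoid b j := AddSubmonoid.subset_closure ⟨l, rfl⟩
    exact ⟨AddMonoidAlgebra.single ⟨_, hl⟩ 1,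
      AddMonoidAlgebra.mapDomain_single.trans (affineEval_coord k hD b hb j l).symm⟩

/-- The generators are the images of the fractions `x_l / x_v`. -/
theorem monomial_mem_chartHom_range {s : {i // i ≠ j} →₀ ℕ} (hs : s ∈ chartMonoid b j) :
    MvPolynomial.monomial s 1 ∈ (chartHom k hD hb hv).range := by
  induction hs using AddSubmonoid.closure_induction with
  | mem s hs =>
    obtain ⟨l, rfl⟩ := hs
    refine ⟨HomogeneousLocalization.mk ⟨1, ⟨_, toricCoord_mem k hD b hb l⟩,
      ⟨_, toricCoord_mem k hD b hb v⟩, Submonoid.mem_powers _⟩, ?_⟩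
    rw [chartHom_mk]
    exact affineEval_coord k hD b hb j l
  | zero => exact one_mem _
  | add s t _ _ hs ht =>
    have := mul_mem hs ht
    rwa [MvPolynomial.monomial_mul, one_mul] at this

theorem chartHom_range : (chartHom k hD hb hv).range =
    (AddMonoidAlgebra.mapDomainAlgHom k k (chartMonoid b j).subtype).toRingHom.range := by
  apply le_antisymm
  · rintro _ ⟨x, rfl⟩
    obtain ⟨c, rfl⟩ := HomogeneousLocalization.mk_surjective x
    rw [chartHom_mk]
    exact affineEval_mem_range k hD hb j _
  · rintro _ ⟨x, rfl⟩
    induction x using AddMonoidAlgebra.induction_linear with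
    | zero => rw [map_zero]; exact zero_mem _
    | add x y hx hy => rw [map_add]; exact add_mem hx hy
    | single s r =>
      have h := mul_mem (s := (chartHom k hD hb hv).range)
        ⟨chartStructure k hD b hb v r, chartHom_structure k hD hb hv r⟩
        (monomial_mem_chartHom_range k hD hb hv s.2)
      have hs : (AddMonoidAlgebra.mapDomainAlgHom k k (chartMonoid b j).subtype).toRingHom
          (AddMonoidAlgebra.single s r) = MvPolynomial.monomial (s : {i // i ≠ j} →₀ ℕ) r :=
        AddMonoidAlgebra.mapDomain_single
      rw [hs]
      rwa [MvPolynomial.algebraMap_eq, MvPolynomial.C_mul_monomial, mul_one] at h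

include hv in
/-- The coordinate ring of the chart at the vertex `D e_j` is the monoid algebra of its monoid of
exponents. -/
theorem exists_chartRing_equiv : ∃ e : chartRing k hD b hb v ≃+* AddMonoidAlgebra k (chartMonoid b j),
    ∀ r, e (chartStructure k hD b hb v r) = algebraMap k _ r := by
  set ι := (AddMonoidAlgebra.mapDomainAlgHom k k (chartMonoid b j).subtype).toRingHom with hι
  have hinj : Function.Injective ι := AddMonoidAlgebra.mapDomain_injective Subtype.val_injective
  have hmem (x) : ∃ y, ι y = chartHom k hD hb hv x := by
    have h : chartHom k hD hb hv x ∈ ι.range := chartHom_range k hD hb hv ▸ ⟨x, rfl⟩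
    exact h
  choose e he using hmem
  let e' : chartRing k hD b hb v →+* AddMonoidAlgebra k (chartMonoid b j) :=
    { toFun := e
      map_one' := hinj (by rw [he, map_one, map_one])
      map_zero' := hinj (by rw [he, map_zero, map_zero])
      map_mul' := fun x y => hinj (by rw [he, map_mul, map_mul, he, he])
      map_add' := fun x y => hinj (by rw [he, map_add, map_add, he, he]) }
  have hbij : Function.Bijective e' := by
    refine ⟨fun x y h => chartHom_injective k hD hb hv ?_, fun y => ?_⟩
    · rw [← he, ← he]
      exact congrArg ι h
    · have h : ι y ∈ (chartHom k hD hb hv).range := (chartHom_range k hD hb hv).symm ▸ ⟨y, rfl⟩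
      obtain ⟨x, hx⟩ := h
      exact ⟨x, hinj ((he x).trans hx)⟩
  refine ⟨RingEquiv.ofBijective e' hbij, fun r => hinj ?_⟩
  refine (he _).trans ((chartHom_structure k hD hb hv r).trans ?_)
  exact ((AddMonoidAlgebra.mapDomainAlgHom k k (chartMonoid b j).subtype).commutes r).symm

include hv in
theorem smooth_chartStructure_iff : (chartStructure k hD b hb v).Smooth ↔
    Algebra.Smooth k (AddMonoidAlgebra k (chartMonoid b j)) := by
  obtain ⟨e, he⟩ := exists_chartRing_equiv k hD hb hv
  let _ : Algebra k (chartRing k hD b hb v) := (chartStructure k hD b hb v).toAlgebra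
  let e' : chartRing k hD b hb v ≃ₐ[k] AddMonoidAlgebra k (chartMonoid b j) :=
    AlgEquiv.ofRingEquiv (f := e) he
  exact ⟨fun (h : Algebra.Smooth k (chartRing k hD b hb v)) => .of_equiv e',
    fun h => (Algebra.Smooth.of_equiv e'.symm : Algebra.Smooth k (chartRing k hD b hb v))⟩

/-! ### Restricting smoothness to the vertex charts and gluing it from them -/

open AlgebraicGeometry

theorem awayι_toricVarietyToSpec (v : Fin (n + 1)) :
    Proj.awayι (toricGrading k hD b hb) _ (toricCoord_mem k hD b hb v) one_pos ≫
      toricVarietyToSpec k hD b hb = Spec.map (CommRingCat.ofHom (chartStructure k hD b hb v)) := by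
  rw [toricVarietyToSpec, projSchemeToSpec]
  erw [Proj.awayι_toSpecZero_assoc]
  rw [← Spec.map_comp]
  rfl

include hv in
theorem smooth_chart_of_smooth [Smooth (toricVarietyToSpec k hD b hb)] :
    Algebra.Smooth k (AddMonoidAlgebra k (chartMonoid b j)) := by
  rw [← smooth_chartStructure_iff k hD hb hv]
  have h : Smooth (Spec.map (CommRingCat.ofHom (chartStructure k hD b hb v))) := by
    rw [← awayι_toricVarietyToSpec]
    exact MorphismProperty.comp_mem @Smooth.{u} _ _
      (inferInstanceAs (Smooth (Proj.awayι _ _ _ _))) ‹_›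
  exact (HasRingHomProperty.Spec_iff (P := @Smooth)).1 h

/-- Both sides have exponent `D b_l`. This makes each `x_l` nilpotent modulo the vertex coordinates,
so the vertex charts suffice. -/
theorem toricCoord_pow (u : Fin (d + 1) → Fin (n + 1)) (hu : ∀ j, b (u j) = Pi.single j D)
    (l : Fin (n + 1)) :
    toricCoord k hD b hb l ^ D = ∏ j, toricCoord k hD b hb (u j) ^ b l j := by
  apply toricEval_injective
  simp only [map_pow, map_prod, toricEval_coord, MvPolynomial.monomial_pow, one_pow, hu]
  rw [← MvPolynomial.monomial_sum_one]
  congr 2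
  ext i
  simp [Finsupp.finsetSum_apply, Finsupp.single_apply, mul_comm]

theorem iSup_basicOpen_toricCoord :
    ⨆ l, Proj.basicOpen (toricGrading k hD b hb) (toricCoord k hD b hb l) = ⊤ := by
  refine Proj.iSup_basicOpen_eq_top' _ _ (fun l => ⟨1, toricCoord_mem k hD b hb l⟩) ?_
  rw [eq_top_iff]
  rintro x -
  obtain ⟨p, rfl⟩ := Ideal.Quotient.mk_surjective x
  induction p using MvPolynomial.induction_on with
  | C r =>
    exact Subalgebra.algebraMap_mem _ (algebraMap k (toricGrading k hD b hb 0) r)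
  | add p q hp hq =>
    rw [map_add]
    exact add_mem hp hq
  | mul_X p l hp =>
    rw [map_mul]
    exact mul_mem hp (Algebra.subset_adjoin ⟨l, rfl⟩)

/-- If `b l j ≠ 0`, then the vertex coordinate `x_{u j}` divides `x_l ^ D`, so the chart of `x_l`
lies in that of `x_{u j}`. -/
theorem iSup_basicOpen_vertex (u : Fin (d + 1) → Fin (n + 1)) (hu : ∀ j, b (u j) = Pi.single j D) :
    ⨆ j, Proj.basicOpen (toricGrading k hD b hb) (toricCoord k hD b hb (u j)) = ⊤ := by
  rw [eq_top_iff, ← iSup_basicOpen_toricCoord k hD hb, iSup_le_iff]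
  intro l
  obtain ⟨j, -, hj⟩ : ∃ j ∈ Finset.univ, b l j ≠ 0 :=
    Finset.exists_ne_zero_of_sum_ne_zero (by rw [hb l]; exact hD.ne')
  refine le_trans ?_ (le_iSup _ j)
  rw [← Proj.basicOpen_pow _ _ D hD, toricCoord_pow k hD hb u hu]
  exact Proj.basicOpen_mono _ _ _
    ((dvd_pow_self _ hj).trans (Finset.dvd_prod_of_mem _ (Finset.mem_univ j)))

/-- `X_b` is smooth as soon as its charts at the vertices are. -/
theorem smooth_of_smooth_charts (u : Fin (d + 1) → Fin (n + 1))
    (hu : ∀ j, b (u j) = Pi.single j D)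
    (h : ∀ j, Algebra.Smooth k (AddMonoidAlgebra k (chartMonoid b j))) :
    Smooth (toricVarietyToSpec k hD b hb) := by
  have : IsZariskiLocalAtSource @Smooth.{u} :=
    HasRingHomProperty.instIsZariskiLocalAtSource (Q := RingHom.Smooth)
  refine IsZariskiLocalAtSource.of_iSup_eq_top (P := @Smooth.{u}) _
    (iSup_basicOpen_vertex k hD hb u hu) fun j => ?_
  have hs : Smooth (Spec.map (CommRingCat.ofHom (chartStructure k hD b hb (u j)))) :=
    (HasRingHomProperty.Spec_iff (P := @Smooth)).2
      ((smooth_chartStructure_iff k hD hb (hu j)).2 (h j))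
  rw [← awayι_toricVarietyToSpec] at hs
  exact smooth_basicOpen_ι_comp _ _ _ _ hs

end Chart

end SimplicialToric

namespace SimplicialToric

universe u

/-! ### The smoothness criterion -/

theorem eq_zero_or_exists_le_of_mem_closure {σ : Type*} {G : Set (σ →₀ ℕ)} {x : σ →₀ ℕ}
    (hx : x ∈ AddSubmonoid.closure G) : x = 0 ∨ ∃ g ∈ G, g ≠ 0 ∧ g ≤ x := by
  induction hx using AddSubmonoid.closure_induction with
  | mem x hx =>
    by_cases h : x = 0
    · exact .inl h
    · exact .inr ⟨x, hx, h, le_rfl⟩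
  | zero => exact .inl rfl
  | add x y _ _ hx hy =>
    rcases hx with rfl | ⟨g, hg, hg0, hgx⟩
    · simpa using hy
    · exact .inr ⟨g, hg, hg0, hgx.trans (le_add_of_nonneg_right zero_le)⟩

/-- The smallest nonzero element of a submonoid of `ℕ^σ` on a coordinate axis belongs to every
generating set. -/
theorem single_mem_of_minimal {σ : Type*} {G : Set (σ →₀ ℕ)} {i : σ} {m : ℕ} (hm : 0 < m)
    (h : Finsupp.single i m ∈ AddSubmonoid.closure G)
    (hmin : ∀ r, 0 < r → Finsupp.single i r ∈ AddSubmonoid.closure G → m ≤ r) :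
    Finsupp.single i m ∈ G := by
  rcases eq_zero_or_exists_le_of_mem_closure h with h0 | ⟨g, hg, hg0, hle⟩
  · simp [hm.ne'] at h0
  · have hgi : g = Finsupp.single i (g i) := by
      ext l
      by_cases hl : l = i
      · simp [hl]
      · have := hle l
        rw [Finsupp.single_eq_of_ne hl] at this ⊢
        omega
    have hpos : 0 < g i := Nat.pos_of_ne_zero fun h0 => hg0 (by rw [hgi, h0]; simp)
    have h1 := hmin _ hpos (hgi ▸ AddSubmonoid.subset_closure hg)
    have h2 : g i ≤ m := by simpa using hle i
    rw [le_antisymm h1 h2, ← hgi]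
    exact hg

section Charts

variable {n d D : ℕ} {b : Fin (n + 1) → Fin (d + 1) → ℕ}

/-- Dropping the `j`-th coordinate of `e_i + (D - 1) e_j` leaves a unit vector. -/
theorem chartMonoid_eq_top (h : ∀ i j, Pi.single i 1 + Pi.single j (D - 1) ∈ Set.range b)
    (j : Fin (d + 1)) : chartMonoid b j = ⊤ := by
  have hsingle (i : {i // i ≠ j}) : Finsupp.single i 1 ∈ chartMonoid b j := by
    obtain ⟨l, hl⟩ := h i j
    refine AddSubmonoid.subset_closure ⟨l, ?_⟩
    ext m
    by_cases hm : m = i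
    · simp [hl, hm, Pi.single_eq_of_ne i.2]
    · have hm' : (m : Fin (d + 1)) ≠ i := fun h => hm (Subtype.ext h)
      simp [hl, Finsupp.single_eq_of_ne hm, Pi.single_eq_of_ne hm', Pi.single_eq_of_ne m.2]
  rw [eq_top_iff]
  rintro y -
  induction y using Finsupp.induction_linear with
  | zero => exact zero_mem _
  | add x y hx hy => exact add_mem hx hy
  | single i m =>
    have := nsmul_mem (hsingle i) m
    simpa using this

theorem smooth_chart_of_eq_top (k : Type*) [Field k] {j : Fin (d + 1)} (h : chartMonoid b j = ⊤) :
    Algebra.Smooth k (AddMonoidAlgebra k (chartMonoid b j)) := by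
  rw [h]
  have : Algebra.Smooth k (MvPolynomial {i // i ≠ j} k) := ⟨inferInstance, inferInstance⟩
  exact .of_equiv (AddMonoidAlgebra.domCongr k k AddSubmonoid.topEquiv.symm :
    MvPolynomial {i // i ≠ j} k ≃ₐ[k] _)

/-- A formally smooth chart at the vertex `D e_j` has a vector `α e_i + (D - α) e_j` on every edge
through that vertex such that `α` divides the `i`-th coordinate of all exponent vectors. -/
theorem exists_edge_vector (k : Type*) [Field k] (hD : 0 < D) (hb : ∀ l, ∑ i, b l i = D)
    (hvert : ∀ i, Pi.single i D ∈ Set.range b) {i j : Fin (d + 1)} (hij : i ≠ j)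
    [Algebra.FormallySmooth k (AddMonoidAlgebra k (chartMonoid b j))] :
    ∃ α, 0 < α ∧ α ≤ D ∧ (∀ l, α ∣ b l i) ∧
      Pi.single i α + Pi.single j (D - α) ∈ Set.range b := by
  classical
  have hex (i : {i // i ≠ j}) : ∃ m, 0 < m ∧ Finsupp.single i m ∈ chartMonoid b j := by
    obtain ⟨l, hl⟩ := hvert i
    refine ⟨D, hD, AddSubmonoid.subset_closure ⟨l, ?_⟩⟩
    ext m
    by_cases hm : m = i
    · simp [hl, hm]
    · have hm' : (m : Fin (d + 1)) ≠ i := fun h => hm (Subtype.ext h)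
      simp [hl, Finsupp.single_eq_of_ne hm, Pi.single_eq_of_ne hm']
  let α (i : {i // i ≠ j}) : ℕ := Nat.find (hex i)
  have hα (i) : 0 < α i ∧ Finsupp.single i (α i) ∈ chartMonoid b j := Nat.find_spec (hex i)
  have hmin (i m) (hm : 0 < m) (h : Finsupp.single i m ∈ chartMonoid b j) : α i ≤ m :=
    Nat.find_min' (hex i) ⟨hm, h⟩
  have hdvd := dvd_of_formallySmooth k (chartMonoid b j) α (fun i => (hα i).1) (fun i => (hα i).2)
    hmin
  -- By minimality `α e_i` is itself a generator, hence comes from one vector `b l`; the degree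
  -- restores its `j`-th coordinate.
  obtain ⟨l, hl⟩ := single_mem_of_minimal (hα ⟨i, hij⟩).1 (hα ⟨i, hij⟩).2 (hmin ⟨i, hij⟩)
  have hl' (m : {m // m ≠ j}) : b l m = Finsupp.single (⟨i, hij⟩ : {m // m ≠ j}) (α ⟨i, hij⟩) m :=
    DFunLike.congr_fun hl m
  have hli : b l i = α ⟨i, hij⟩ := by simpa using hl' ⟨i, hij⟩
  have hlm (m) (hmi : m ≠ i) (hmj : m ≠ j) : b l m = 0 := by
    have := hl' ⟨m, hmj⟩
    rwa [Finsupp.single_eq_of_ne (by simpa using hmi)] at this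
  have hlj : α ⟨i, hij⟩ + b l j = D := by
    rw [← hb l, ← hli, ← Finset.sum_pair hij]
    refine Finset.sum_subset (Finset.subset_univ _) fun m _ hm => ?_
    simp only [Finset.mem_insert, Finset.mem_singleton, not_or] at hm
    exact hlm m hm.1 hm.2
  refine ⟨α ⟨i, hij⟩, (hα _).1, by omega,
    fun l => hdvd _ (AddSubmonoid.subset_closure ⟨l, rfl⟩) ⟨i, hij⟩, l, ?_⟩
  funext m
  by_cases hmi : m = i
  · subst hmi
    simp [Pi.single_eq_of_ne hij, hli]
  · by_cases hmj : m = j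
    · subst hmj
      simp [Pi.single_eq_of_ne hmi]
      omega
    · simp [Pi.single_eq_of_ne hmi, Pi.single_eq_of_ne hmj, hlm m hmi hmj]

theorem single_add_single_mem_of_formallySmooth (k : Type*) [Field k] (hD : 0 < D)
    (hb : ∀ l, ∑ i, b l i = D) (hvert : ∀ i, Pi.single i D ∈ Set.range b)
    (hgcd : ∀ p, (∀ l i, p ∣ b l i) → p = 1)
    (h : ∀ j, Algebra.FormallySmooth k (AddMonoidAlgebra k (chartMonoid b j)))
    (i j : Fin (d + 1)) : Pi.single i 1 + Pi.single j (D - 1) ∈ Set.range b := by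
  by_cases hij : i = j
  · subst hij
    rw [← Pi.single_add, Nat.add_sub_cancel' (by omega : 1 ≤ D)]
    exact hvert i
  obtain ⟨α, -, -, hdvd, hmem⟩ := exists_edge_vector k hD hb hvert hij
  have hα : α = 1 := by
    refine hgcd α fun l m => ?_
    by_cases hm : m = i
    · exact hm ▸ hdvd l
    -- Move to the chart at the vertex `D e_i`: its edge vector towards `m` is `β e_m + (D - β)
    -- e_i`. Since `α` divides every `i`-th coordinate, it divides both `D` and `D - β`, hence `β`,
    -- which divides every `m`-th coordinate.
    obtain ⟨β, -, hβD, hβ, l', hl'⟩ := exists_edge_vector k hD hb hvert hm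
    refine dvd_trans ?_ (hβ l)
    obtain ⟨l'', hl''⟩ := hvert i
    have h1 : α ∣ D := by simpa [hl''] using hdvd l''
    have h2 : α ∣ D - β := by simpa [hl', Pi.single_eq_of_ne (Ne.symm hm)] using hdvd l'
    have h3 := Nat.dvd_sub h1 h2
    rwa [Nat.sub_sub_self hβD] at h3
  rwa [hα] at hmem

/-- A simplicial projective toric variety is smooth if and only if all the vectors
`e_i + (D - 1) e_j` occur among its exponent vectors. -/
theorem smooth_toricVarietyToSpec_iff (k : Type u) [Field k] (hD : 0 < D)
    (hb : ∀ l, ∑ i, b l i = D) (hvert : ∀ i, Pi.single i D ∈ Set.range b)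
    (hgcd : ∀ p, (∀ l i, p ∣ b l i) → p = 1) :
    AlgebraicGeometry.Smooth (toricVarietyToSpec k hD b hb) ↔
      ∀ i j, Pi.single i 1 + Pi.single j (D - 1) ∈ Set.range b := by
  choose u hu using hvert
  constructor
  · intro h
    exact single_add_single_mem_of_formallySmooth k hD hb (fun i => ⟨u i, hu i⟩) hgcd fun j =>
      (smooth_chart_of_smooth k hD hb (hu j)).formallySmooth
  · intro h
    exact smooth_of_smooth_charts k hD hb u hu fun j =>
      smooth_chart_of_eq_top k (chartMonoid_eq_top h j)

end Charts

end SimplicialToric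

open SimplicialToric in
theorem mainTheorem10 {k : Type*} [Field k] [IsAlgClosed k] {n d D : ℕ}
    (hd : 1 ≤ d) (hn : d ≤ n) (hD : 2 ≤ D)
    (a : Fin (n + 1) → Fin d → ℕ) (ha : Function.Injective a)
    (hzero : 0 ∈ Set.range a)
    (hvert : ∀ i : Fin d, Pi.single i D ∈ Set.range a)
    (hdeg : ∀ i, ∑ j, a i j ≤ D)
    (hgcd : (Finset.univ : Finset (Fin (n + 1) × Fin (d + 1))).gcd
      (fun p => homogenize D (a p.1) p.2) = 1) :
    List.TFAE
      [ AlgebraicGeometry.Smooth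
          (toricVarietyToSpec k (D := D) (Nat.lt_of_lt_of_le Nat.zero_lt_two hD) (fun i => homogenize D (a i))
            (fun i => sum_homogenize (hdeg i))),
        ∀ i j : Fin (d + 1),
          Pi.single i 1 + Pi.single j (D - 1) ∈ Set.range (fun l => homogenize D (a l)),
        0 ∈ Set.range a ∧
          (∀ i : Fin d, Pi.single i 1 ∈ Set.range a ∧ Pi.single i (D - 1) ∈ Set.range a) ∧
          ∀ i j : Fin d, Pi.single i 1 + Pi.single j (D - 1) ∈ Set.range a,
        ∃ s₀ : ℕ, ∀ s ≥ s₀, sumset s (Set.range a) = simplex d D s ] := by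
  have hD' : 0 < D := by omega
  tfae_have 1 ↔ 2 := by
    refine smooth_toricVarietyToSpec_iff k hD' (fun i => sum_homogenize (hdeg i))
      (single_mem_range_homogenize hdeg hzero hvert) fun p hp => ?_
    rw [← Nat.dvd_one, ← hgcd]
    exact Finset.dvd_gcd fun q _ => hp q.1 q.2
  tfae_have 2 ↔ 3 := forall_single_add_single_mem_iff hD' hdeg
  tfae_have 4 ↔ 2 := exists_forall_sumset_eq_simplex_iff hD' hdeg hzero hvert
  tfae_finish
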